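/- Let $n\ge 0$ be an integer. Write $D^\alpha$ for partial derivatives, $|\alpha|=\alpha_1+\dots+\alpha_n$, $\beta!=\beta_1!\cdots\beta_n!$, $|x|$ for the vector $(|x_1|,\dots,|x_n|)$, $\|x\|$ for the Euclidean norm on $\mathbb R^n$, $g^*(x)=\sup_{y\in\mathbb R^n}(\langle x,y\rangle-g(y))$ for the Young–Fenchel conjugate of $g:\mathbb R^n\to[-\infty,\infty]$, and $u[e](x)=u(e^{x_1},\dots,e^{x_n})$. All function spaces below consist of complex-valued functions on $\mathbb R^n$. **(a)** Let $\mathcal M=\{M_\nu\}_{\nu\ge1}$ be a family of convex functions $M_\nu:\mathbb R^n\to\mathbb R$ such that for each $\nu$: $j_1)$ $M_\nu(x)=M_\nu(|x_1|,\dots,|x_n|)$; $j_2)$ $M_\nu$ restricted to $[0,\infty)^n$ is nondecreasing in each variable; $j_3)$ $M_\nu(x)/\|x\|\to+\infty$ as $x\to\infty$; $j_4)$ there is $A_\nu>0$ with $M_{\nu+1}(2x)\le M_\nu(x)+A_\nu$ for all $x\in\mathbb R^n$. Let $\psi_\nu(x)=M_\nu^*[e](|x_1|,\dots,|x_n|)$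 and $h_\nu=\psi_\nu^*$. Then each $h_\nu$ is a finite-valued convex function on $\mathbb R^n$, and for each $\nu$: 1) $h_\nu(x)=h_\nu(|x_1|,\dots,|x_n|)$; 2) $h_\nu$ restricted to $[0,\infty)^n$ is nondecreasing in each variable; 3) $h_\nu(x)/\|x\|\to+\infty$ as $x\to\infty$; 4) for each $K>0$ there is $A_{\nu,K}>0$ with $h_\nu(x)\le\sum_{j:\,x_j\ne0}x_j\ln\frac{x_j}{K}+A_{\nu,K}$ on $[0,\infty)^n$; 5) there is $\gamma_\nu\in\mathbb R$ with $h_\nu(x)-h_{\nu+1}(x)\ge\ln2\sum_jx_j-\gamma_\nu$ on $[0,\infty)^n$; 6) there is $l_\nu\in\mathbb R$ with $h_{\nu+1}(x+y)\le h_\nu(x)+h_\nu(y)+l_\nu$ for $x,y\in[0,\infty)^n$. Moreover $GS(\mathcal M)=G(\mathcal H)$, with the same elements and the same topology. Here $GS(\mathcal M)=\bigcup_\nu GS(M_\nu)$ and $G(\mathcal H)=\bigcup_\nu G(h_\nu)$ carry the locally convex inductive limit topologies. The space $GS(M_\nu)$ (respectively $G(h_\nu)$) consists of the $f\in C^\infty(\mathbb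 R^n)$ for which all norms $$q_{m,\nu}(f)=\sup_{x\in\mathbb R^n,\ |\alpha|\le m}\frac{|(D^\alpha f)(x)|}{e^{-M_\nu(x)}}\qquad\Big(\text{respectively }\ \|f\|_{m,h_\nu}=\sup_{x\in\mathbb R^n,\ \beta\in\mathbb Z_+^n,\ |\alpha|\le m}\frac{|x^\beta(D^\alpha f)(x)|}{\beta!\,e^{-h_\nu(\beta)}}\Big),$$ $m=0,1,2,\dots$, are finite, and it has the topology defined by these norms. **(b)** In particular $G(\mathcal H)$ generalizes the Gelfand–Shilov space $W_M$. Let $\mu_1,\dots,\mu_n:[0,\infty)\to\mathbb R$ be continuous and nondecreasing with $\mu_j(0)=0$ and $\mu_j(t)\to\infty$ as $t\to\infty$. Put $M(x)=\sum_j\int_0^{|x_j|}\mu_j(t)\,dt$, and let $W_M$ be the space of $f\in C^\infty(\mathbb R^n)$ for which there is $a>0$ with $\sup_x|(D^\alpha f)(x)|e^{M(ax)}<\infty$ for every $\alpha$. That is, $W_M=\bigcup_{a>0}GS(M(a\,\cdot))$, with the locally convex inductive limit topology. Then the family $M_\nu(x)=M(2^{-\nu}x)$, $\nu=0,1,2,\dots$,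 is convex and satisfies $j_1)$–$j_4)$, and for the corresponding family $\mathcal H$ we have $W_M=G(\mathcal H)$, with the same elements and the same topology. -/

import Mathlib

open Filter Topology
open scoped Nat

noncomputable section

namespace GelfandShilov

/-- `ℝⁿ` with its Euclidean norm. -/
abbrev Rn (n : ℕ) : Type := EuclideanSpace ℝ (Fin n)

/-- The vector `(|x₁|, …, |xₙ|)`. -/
def absVec {n : ℕ} (x : Rn n) : Rn n := WithLp.toLp 2 fun j => |x j|

/-- The vector `(exp x₁, …, exp xₙ)`. -/
def expVec {n : ℕ} (x : Rn n) : Rn n := WithLp.toLp 2 fun j => Real.exp (x j)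

/-- A multi-index regarded as a vector of `ℝⁿ`. -/
def natVec {n : ℕ} (β : Fin n → ℕ) : Rn n := WithLp.toLp 2 fun j => (β j : ℝ)

/-- `x ∈ [0, ∞)ⁿ`. -/
def Orthant {n : ℕ} (x : Rn n) : Prop := ∀ j, 0 ≤ x j

/-! ### Young-Fenchel conjugation and the weights `h_ν` -/

/-- The Young-Fenchel conjugate `g*(x) = sup_y (⟨x, y⟩ - g(y))` of `g : ℝⁿ → [-∞, ∞]`. -/
def conj {n : ℕ} (g : Rn n → EReal) (x : Rn n) : EReal :=
  ⨆ y : Rn n, (((∑ j, x j * y j : ℝ) : EReal) - g y)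

/-- `u[e](x) = u(e^{x₁}, …, e^{xₙ})`. -/
def compExp {n : ℕ} (u : Rn n → EReal) (x : Rn n) : EReal := u (expVec x)

/-- `ψ(x) = M*[e](|x₁|, …, |xₙ|)`. -/
def psi {n : ℕ} (M : Rn n → ℝ) (x : Rn n) : EReal :=
  compExp (conj fun y => (M y : EReal)) (absVec x)

/-- The real-valued function `h` is the conjugate `ψ*` of `ψ = M*[e](|·|)`; in particular `ψ*`
has only finite values. -/
def IsConjWeight {n : ℕ} (M h : Rn n → ℝ) : Prop := ∀ x, (h x : EReal) = conj (psi M) x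

/-! ### The conditions on the families of weights -/

/-- Convexity and the conditions `j₁)`, `j₂)`, `j₃)`, `j₄)` on a family `M_ν`. -/
structure IsGSFamily {n : ℕ} (M : ℕ → Rn n → ℝ) : Prop where
  convex : ∀ ν, ConvexOn ℝ Set.univ (M ν)
  even : ∀ ν x, M ν x = M ν (absVec x)
  mono : ∀ ν x y, Orthant x → Orthant y → (∀ j, x j ≤ y j) → M ν x ≤ M ν y
  superlinear : ∀ ν, Tendsto (fun x => M ν x / ‖x‖) (Bornology.cobounded (Rn n)) atTop
  doubling : ∀ ν, ∃ A : ℝ, 0 < A ∧ ∀ x, M (ν + 1) ((2 : ℝ) • x) ≤ M ν x + A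

/-- Convexity and the conditions `1)`, …, `6)` on a family `h_ν`. In `upper`, a coordinate
`x j = 0` contributes `0` to the sum. -/
structure IsHFamily {n : ℕ} (h : ℕ → Rn n → ℝ) : Prop where
  convex : ∀ ν, ConvexOn ℝ Set.univ (h ν)
  even : ∀ ν x, h ν x = h ν (absVec x)
  mono : ∀ ν x y, Orthant x → Orthant y → (∀ j, x j ≤ y j) → h ν x ≤ h ν y
  superlinear : ∀ ν, Tendsto (fun x => h ν x / ‖x‖) (Bornology.cobounded (Rn n)) atTop
  upper : ∀ ν, ∀ K : ℝ, 0 < K → ∃ A : ℝ, 0 < A ∧ ∀ x, Orthant x →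
    h ν x ≤ (∑ j, x j * Real.log (x j / K)) + A
  gap : ∀ ν, ∃ γ : ℝ, ∀ x, Orthant x → Real.log 2 * (∑ j, x j) - γ ≤ h ν x - h (ν + 1) x
  subadd : ∀ ν, ∃ l : ℝ, ∀ x y, Orthant x → Orthant y →
    h (ν + 1) (x + y) ≤ h ν x + h ν y + l

/-! ### Spaces of smooth functions given by weighted suprema of derivatives -/

/-- The partial derivative `D^α f (x) = ∂₁^{α₁} ⋯ ∂ₙ^{αₙ} f (x)` of a function of class `C^{|α|}`:
the `|α|`-th Fréchet derivative evaluated at `α₁` copies of `e₁`, …, `αₙ` copies of `eₙ`. -/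
def partialD {n : ℕ} (α : Fin n → ℕ) (f : Rn n → ℂ) (x : Rn n) : ℂ :=
  iteratedFDeriv ℝ (∑ j, α j) f x
    (fun k => EuclideanSpace.single (finSigmaFinEquiv.symm k).1 (1 : ℝ))

section Weighted

variable {n : ℕ} {ι : Type}

/-- The quantities `|w_i(x) (D^α f)(x)|` with `|α| ≤ m`, for a family `w_i` of real weights. -/
def quot (w : ι → Rn n → ℝ) (m : ℕ) (f : Rn n → ℂ)
    (p : ι × {α : Fin n → ℕ // ∑ j, α j ≤ m} × Rn n) : ℝ :=
  |w p.1 p.2.2| * ‖partialD p.2.1.1 f p.2.2‖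

theorem partialD_add {m : ℕ} {f g : Rn n → ℂ} (hf : ContDiff ℝ m f) (hg : ContDiff ℝ m g)
    (α : Fin n → ℕ) (hα : ∑ j, α j ≤ m) (x : Rn n) :
    partialD α (f + g) x = partialD α f x + partialD α g x := by
  have h : ((∑ j, α j : ℕ) : WithTop ℕ∞) ≤ m := by exact_mod_cast hα
  unfold partialD
  rw [iteratedFDeriv_add_apply (hf.of_le h).contDiffAt (hg.of_le h).contDiffAt]
  rfl

theorem partialD_smul {m : ℕ} {f : Rn n → ℂ} (hf : ContDiff ℝ m f) (c : ℂ)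
    (α : Fin n → ℕ) (hα : ∑ j, α j ≤ m) (x : Rn n) :
    partialD α (c • f) x = c * partialD α f x := by
  have h : ((∑ j, α j : ℕ) : WithTop ℕ∞) ≤ m := by exact_mod_cast hα
  unfold partialD
  rw [iteratedFDeriv_const_smul_apply (hf.of_le h).contDiffAt]
  rfl

theorem quot_add_le (w : ι → Rn n → ℝ) {m : ℕ} {f g : Rn n → ℂ} (hf : ContDiff ℝ m f)
    (hg : ContDiff ℝ m g) (p) : quot w m (f + g) p ≤ quot w m f p + quot w m g p := by
  unfold quot
  rw [partialD_add hf hg _ p.2.1.2, ← mul_add]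
  exact mul_le_mul_of_nonneg_left (norm_add_le _ _) (abs_nonneg _)

theorem quot_smul (w : ι → Rn n → ℝ) {m : ℕ} {f : Rn n → ℂ} (hf : ContDiff ℝ m f) (c : ℂ) (p) :
    quot w m (c • f) p = ‖c‖ * quot w m f p := by
  unfold quot
  rw [partialD_smul hf _ _ p.2.1.2, norm_mul]
  ring

/-- The functions `f` of class `C^m` with `sup_{i, |α| ≤ m, x} |w_i(x) (D^α f)(x)| < ∞`. -/
def stepSpace (w : ι → Rn n → ℝ) (m : ℕ) : Submodule ℂ (Rn n → ℂ) where
  carrier := {f | ContDiff ℝ m f ∧ BddAbove (Set.range (quot w m f))}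
  zero_mem' := by
    refine ⟨contDiff_const, 0, ?_⟩
    rintro _ ⟨p, rfl⟩
    have := quot_smul w (contDiff_const (c := (0 : ℂ)) : ContDiff ℝ m fun _ : Rn n => (0 : ℂ)) 0 p
    rw [zero_smul, norm_zero, zero_mul] at this
    exact this.le
  add_mem' := by
    rintro f g ⟨hf, A, hA⟩ ⟨hg, B, hB⟩
    refine ⟨hf.add hg, A + B, ?_⟩
    rintro _ ⟨p, rfl⟩
    exact (quot_add_le w hf hg p).trans (add_le_add (hA ⟨p, rfl⟩) (hB ⟨p, rfl⟩))
  smul_mem' := by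
    rintro c f ⟨hf, A, hA⟩
    refine ⟨contDiff_const.smul hf, ‖c‖ * A, ?_⟩
    rintro _ ⟨p, rfl⟩
    rw [quot_smul w hf]
    exact mul_le_mul_of_nonneg_left (hA ⟨p, rfl⟩) (norm_nonneg _)

/-- The intersection over all `m` of the spaces `stepSpace w m`. -/
def weightedSpace (w : ι → Rn n → ℝ) : Submodule ℂ (Rn n → ℂ) := ⨅ m : ℕ, stepSpace w m

theorem mem_weightedSpace {w : ι → Rn n → ℝ} {f : Rn n → ℂ} :
    f ∈ weightedSpace w ↔ ∀ m : ℕ, ContDiff ℝ m f ∧ BddAbove (Set.range (quot w m f)) := by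
  unfold weightedSpace
  rw [Submodule.mem_iInf]
  rfl

/-- The norm `f ↦ sup_{i, |α| ≤ m, x} |w_i(x) (D^α f)(x)|`, as a seminorm on `weightedSpace w`. -/
def weightedNorm (w : ι → Rn n → ℝ) : SeminormFamily ℂ (weightedSpace w) ℕ := fun m =>
  Seminorm.of (fun f => ⨆ p, quot w m (f : Rn n → ℂ) p)
    (by
      intro f g
      have hf := mem_weightedSpace.1 f.2 m
      have hg := mem_weightedSpace.1 g.2 m
      refine Real.iSup_le (fun p => ?_) (add_nonneg ?_ ?_)
      · exact (quot_add_le w hf.1 hg.1 p).trans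
          (add_le_add (le_ciSup hf.2 p) (le_ciSup hg.2 p))
      · exact Real.iSup_nonneg fun p => mul_nonneg (abs_nonneg _) (norm_nonneg _)
      · exact Real.iSup_nonneg fun p => mul_nonneg (abs_nonneg _) (norm_nonneg _))
    (by
      intro c f
      have hf := mem_weightedSpace.1 f.2 m
      have h : quot w m ((c • f : weightedSpace w) : Rn n → ℂ)
          = fun p => ‖c‖ * quot w m (f : Rn n → ℂ) p :=
        funext fun p => quot_smul w hf.1 c p
      rw [h, Real.mul_iSup_of_nonneg (norm_nonneg c)])

/-- The topology of `weightedSpace w` defined by the family of all norms `weightedNorm w m`. -/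
@[reducible] def weightedTopology (w : ι → Rn n → ℝ) : TopologicalSpace (weightedSpace w) :=
  (weightedNorm w).moduleFilterBasis.topology

/-- A weight family bounded by a multiple of another one gives a larger space. -/
theorem weightedSpace_le {w v : ι → Rn n → ℝ} (C : ℝ) (h : ∀ i x, |v i x| ≤ C * |w i x|) :
    weightedSpace w ≤ weightedSpace v := by
  intro f hf
  rw [mem_weightedSpace] at hf ⊢
  intro m
  obtain ⟨h1, A, hA⟩ := hf m
  refine ⟨h1, |C| * A, ?_⟩
  rintro _ ⟨p, rfl⟩
  have hp : quot w m f p ≤ A := hA ⟨p, rfl⟩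
  calc quot v m f p ≤ (|C| * |w p.1 p.2.2|) * ‖partialD p.2.1.1 f p.2.2‖ :=
        mul_le_mul_of_nonneg_right ((h _ _).trans
          (mul_le_mul_of_nonneg_right (le_abs_self C) (abs_nonneg _))) (norm_nonneg _)
    _ = |C| * quot w m f p := by unfold quot; ring
    _ ≤ |C| * A := mul_le_mul_of_nonneg_left hp (abs_nonneg _)

end Weighted

/-! ### Unions of directed families of spaces, with the inductive limit topology -/

section Union

variable {V κ : Type} [AddCommGroup V] [Module ℂ V] [Nonempty κ]

/-- The union of a directed family of subspaces. -/
def unionSpace (S : κ → Submodule ℂ V) (hS : Directed (· ≤ ·) S) : Submodule ℂ V where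
  carrier := ⋃ k, (S k : Set V)
  zero_mem' := Set.mem_iUnion.2 ⟨Classical.arbitrary κ, (S _).zero_mem⟩
  add_mem' := by
    intro f g hf hg
    obtain ⟨a, ha⟩ := Set.mem_iUnion.1 hf
    obtain ⟨b, hb⟩ := Set.mem_iUnion.1 hg
    obtain ⟨c, hac, hbc⟩ := hS a b
    exact Set.mem_iUnion.2 ⟨c, (S c).add_mem (hac ha) (hbc hb)⟩
  smul_mem' := by
    intro c f hf
    obtain ⟨a, ha⟩ := Set.mem_iUnion.1 hf
    exact Set.mem_iUnion.2 ⟨a, (S a).smul_mem c ha⟩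

theorem le_unionSpace (S : κ → Submodule ℂ V) (hS : Directed (· ≤ ·) S) (k : κ) :
    S k ≤ unionSpace S hS := fun _ hf => Set.mem_iUnion.2 ⟨k, hf⟩

/-- The (locally convex) inductive limit topology on the union: the finest locally convex vector
space topology for which all inclusions of the given spaces are continuous. -/
@[reducible] def indLimTopology (S : κ → Submodule ℂ V) (hS : Directed (· ≤ ·) S)
    (τ : ∀ k, TopologicalSpace (S k)) : TopologicalSpace (unionSpace S hS) :=
  sInf {t : TopologicalSpace (unionSpace S hS) |
    @IsTopologicalAddGroup _ t _ ∧ @ContinuousSMul ℂ _ _ _ t ∧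
    @LocallyConvexSpace ℝ _ _ _ _ _ t ∧
    ∀ k, @Continuous _ _ (τ k) t (Submodule.inclusion (le_unionSpace S hS k))}

end Union

/-- Equality of two subspaces of one vector space, each with its own topology: they have the same
elements and the same topology, the identity map being a homeomorphism. -/
def EqTop {V : Type} [AddCommGroup V] [Module ℂ V] (S T : Submodule ℂ V)
    (τS : TopologicalSpace S) (τT : TopologicalSpace T) : Prop :=
  ∃ e : S = T, @IsHomeomorph S T τS τT (LinearEquiv.ofEq S T e)

/-! ### The spaces `GS(𝓜)` -/

/-- The weight `1 / e^{-M(x)}`. -/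
def gsWeight {n : ℕ} (M : Rn n → ℝ) : Unit → Rn n → ℝ := fun _ x => 1 / Real.exp (-M x)

/-- `GS(M_ν)`. -/
abbrev gsSpace {n : ℕ} (M : Rn n → ℝ) : Submodule ℂ (Rn n → ℂ) := weightedSpace (gsWeight M)

theorem gsSpace_le {n : ℕ} {M N : Rn n → ℝ} (A : ℝ) (h : ∀ x, N x ≤ M x + A) :
    gsSpace M ≤ gsSpace N := by
  refine weightedSpace_le (Real.exp A) fun _ x => ?_
  simp only [gsWeight, Real.exp_neg, one_div, inv_inv, abs_of_pos (Real.exp_pos _)]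
  rw [← Real.exp_add]
  exact Real.exp_le_exp.2 (by linarith [h x])

theorem IsGSFamily.directed {n : ℕ} {M : ℕ → Rn n → ℝ} (hM : IsGSFamily M) :
    Directed (· ≤ ·) fun ν => gsSpace (M ν) := by
  refine (monotone_nat_of_le_succ fun ν => ?_).directed_le
  obtain ⟨A, -, hA⟩ := hM.doubling ν
  refine gsSpace_le A fun x => le_trans ?_ (hA x)
  rw [hM.even (ν + 1) x, hM.even (ν + 1) ((2 : ℝ) • x)]
  refine hM.mono _ _ _ (fun j => abs_nonneg _) (fun j => abs_nonneg _) fun j => ?_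
  have : |x j| ≤ |2 * x j| := by
    rw [abs_mul, abs_two]
    linarith [abs_nonneg (x j)]
  simpa [absVec] using this

/-- `GS(𝓜) = ⋃_ν GS(M_ν)`. -/
def GS {n : ℕ} (M : ℕ → Rn n → ℝ) (hM : IsGSFamily M) : Submodule ℂ (Rn n → ℂ) :=
  unionSpace (fun ν => gsSpace (M ν)) hM.directed

/-- The inductive limit topology of `GS(𝓜)`. -/
@[reducible] def gsTopology {n : ℕ} (M : ℕ → Rn n → ℝ) (hM : IsGSFamily M) :
    TopologicalSpace (GS M hM) :=
  indLimTopology (fun ν => gsSpace (M ν)) hM.directed fun ν => weightedTopology (gsWeight (M ν))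

/-! ### The spaces `G(𝓗)` -/

/-- The weights `x^β / (β! e^{-h(β)})`, indexed by the multi-indices `β`. -/
def gWeight {n : ℕ} (h : Rn n → ℝ) : (Fin n → ℕ) → Rn n → ℝ := fun β x =>
  (∏ j, x j ^ β j) / ((∏ j, ((β j)! : ℝ)) * Real.exp (-h (natVec β)))

/-- `G(h_ν)`. -/
abbrev gSpace {n : ℕ} (h : Rn n → ℝ) : Submodule ℂ (Rn n → ℂ) := weightedSpace (gWeight h)

theorem IsHFamily.directed {n : ℕ} {h : ℕ → Rn n → ℝ} (hh : IsHFamily h) :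
    Directed (· ≤ ·) fun ν => gSpace (h ν) := by
  refine (monotone_nat_of_le_succ fun ν => ?_).directed_le
  obtain ⟨γ, hγ⟩ := hh.gap ν
  refine weightedSpace_le (Real.exp γ) fun β x => ?_
  have h0 : Orthant (natVec β) := fun j => Nat.cast_nonneg _
  have h1 : 0 ≤ Real.log 2 * ∑ j, natVec β j :=
    mul_nonneg (Real.log_nonneg one_le_two) (Finset.sum_nonneg fun j _ => h0 j)
  have h2 : h (ν + 1) (natVec β) ≤ γ + h ν (natVec β) := by linarith [hγ _ h0]
  have h3 : ∀ u : ℝ, |(∏ j, x j ^ β j) / ((∏ j, ((β j)! : ℝ)) * Real.exp (-u))|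
      = |(∏ j, x j ^ β j) / (∏ j, ((β j)! : ℝ))| * Real.exp u := by
    intro u
    rw [← div_div, abs_div, abs_of_pos (Real.exp_pos _), Real.exp_neg, div_inv_eq_mul]
  simp only [gWeight]
  rw [h3, h3, mul_left_comm, ← Real.exp_add]
  exact mul_le_mul_of_nonneg_left (Real.exp_le_exp.2 h2) (abs_nonneg _)

/-- `G(𝓗) = ⋃_ν G(h_ν)`. -/
def G {n : ℕ} (h : ℕ → Rn n → ℝ) (hh : IsHFamily h) : Submodule ℂ (Rn n → ℂ) :=
  unionSpace (fun ν => gSpace (h ν)) hh.directed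

/-- The inductive limit topology of `G(𝓗)`. -/
@[reducible] def gTopology {n : ℕ} (h : ℕ → Rn n → ℝ) (hh : IsHFamily h) :
    TopologicalSpace (G h hh) :=
  indLimTopology (fun ν => gSpace (h ν)) hh.directed fun ν => weightedTopology (gWeight (h ν))

/-! ### The classical space `W_M` -/

/-- Gelfand and Shilov's assumptions on the functions `μ_j : [0, ∞) → ℝ`. -/
structure IsWDensity {n : ℕ} (μ : Fin n → ℝ → ℝ) : Prop where
  continuousOn : ∀ j, ContinuousOn (μ j) (Set.Ici 0)
  monotoneOn : ∀ j, MonotoneOn (μ j) (Set.Ici 0)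
  zero : ∀ j, μ j 0 = 0
  tendsto : ∀ j, Tendsto (μ j) atTop atTop

/-- `M(x) = M₁(x₁) + ⋯ + Mₙ(xₙ)` with `M_j(s) = ∫_0^{|s|} μ_j(t) dt`. -/
def wFun {n : ℕ} (μ : Fin n → ℝ → ℝ) (x : Rn n) : ℝ := ∑ j, ∫ t in (0 : ℝ)..|x j|, μ j t

theorem IsWDensity.wFun_le {n : ℕ} {μ : Fin n → ℝ → ℝ} (hμ : IsWDensity μ) {a b : ℝ}
    (ha : 0 < a) (hab : a ≤ b) (x : Rn n) : wFun μ (a • x) ≤ wFun μ (b • x) := by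
  refine Finset.sum_le_sum fun j _ => ?_
  have h1 : |(a • x) j| ≤ |(b • x) j| := by
    simp only [PiLp.smul_apply, smul_eq_mul, abs_mul, abs_of_pos ha, abs_of_pos (ha.trans_le hab)]
    exact mul_le_mul_of_nonneg_right hab (abs_nonneg _)
  refine intervalIntegral.integral_mono_interval le_rfl (abs_nonneg _) h1 ?_ ?_
  · refine (MeasureTheory.ae_restrict_mem measurableSet_Ioc).mono fun t ht => ?_
    have := hμ.monotoneOn j (Set.mem_Ici.2 le_rfl) (Set.mem_Ici.2 ht.1.le) ht.1.le
    rw [hμ.zero j] at this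
    exact this
  · refine ((hμ.continuousOn j).mono fun t ht => ?_).intervalIntegrable
    rw [Set.uIcc_of_le (abs_nonneg _)] at ht
    exact ht.1

theorem IsWDensity.directed {n : ℕ} {μ : Fin n → ℝ → ℝ} (hμ : IsWDensity μ) :
    Directed (· ≤ ·) fun a : {a : ℝ // 0 < a} => gsSpace fun x => wFun μ (a.1 • x) := by
  intro a b
  refine ⟨⟨min a.1 b.1, lt_min a.2 b.2⟩, ?_, ?_⟩
  · exact gsSpace_le 0 fun x => by
      rw [add_zero]; exact hμ.wFun_le (lt_min a.2 b.2) (min_le_left _ _) x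
  · exact gsSpace_le 0 fun x => by
      rw [add_zero]; exact hμ.wFun_le (lt_min a.2 b.2) (min_le_right _ _) x

instance : Nonempty {a : ℝ // 0 < a} := ⟨⟨1, one_pos⟩⟩

/-- `W_M`: the functions `f` for which there is `a > 0` such that, for every `α`,
`|(D^α f)(x)| ≤ C_α e^{-M(ax)}`. -/
def W {n : ℕ} (μ : Fin n → ℝ → ℝ) (hμ : IsWDensity μ) : Submodule ℂ (Rn n → ℂ) :=
  unionSpace (fun a : {a : ℝ // 0 < a} => gsSpace fun x => wFun μ (a.1 • x)) hμ.directed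

/-- The inductive limit topology (over `a > 0`) of `W_M`. -/
@[reducible] def wTopology {n : ℕ} (μ : Fin n → ℝ → ℝ) (hμ : IsWDensity μ) :
    TopologicalSpace (W μ hμ) :=
  indLimTopology (fun a : {a : ℝ // 0 < a} => gsSpace fun x => wFun μ (a.1 • x)) hμ.directed
    fun a => weightedTopology (gsWeight fun x => wFun μ (a.1 • x))

end GelfandShilov

end

open GelfandShilov

noncomputable section

namespace GelfandShilov

/-! ### Real-valued Young-Fenchel conjugation -/

section Conjugate

variable {n : ℕ}

/-! Every space here is cut out by weighted suprema of the same derivatives. If each weight of one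
family is dominated, point by point, by a constant times some weight of another, then the spaces are
nested, continuously and without loss of order (`contLE_of_weight_le`). Mutually cofinal inductive
families have the same limit (`eqTop_indLimTopology`). So two bounds on `|x^β| / β! · e^{h(β)}`
suffice.

From above (`abs_gWeight_le`): `t^k / k! ≤ e^t` at `t = |x_j| e^{|u_j|}`, with Young's inequality
for `M`, gives `log (|x^β| / β!) + ⟨β, u⟩ ≤ M(x) + ψ(u)`; the supremum over `u` produces `h(β)`.

From below (`exists_exp_le_abs_gWeight`): take an almost-subgradient `ξ` of `M_{ν+1}` at `|x|/2`,
put `u_j = log (ξ_j + 1)`, and choose `β_j` so that one term of the exponential series at `|x_j|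
e^{u_j}` carries enough of its sum. Then `h_ν(β) ≥ ⟨β, u⟩ - ψ_ν(u)`, and `j₄)` in conjugate form
bounds `ψ_ν(u)` by `M_{ν+1}*(ξ)` plus a constant.

The properties of `h_ν` come from the same conjugate form of `j₄)` and from testing Young's
inequality at well-chosen vectors. For `W_M`, the dilations by `2^{-ν}` are cofinal among all
dilations. -/

/-- Superlinear growth, quantitatively and with respect to the `ℓ¹`-norm. -/
def Superlin (g : Rn n → ℝ) : Prop := ∀ K : ℝ, ∃ C : ℝ, ∀ y, K * ∑ j, |y j| - C ≤ g y

/-- The Young-Fenchel conjugate of a real function of superlinear growth. -/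
def conjR (g : Rn n → ℝ) (x : Rn n) : ℝ := ⨆ y : Rn n, (∑ j, x j * y j - g y)

theorem sum_mul_le_abs (x y : Rn n) : ∑ j, x j * y j ≤ ∑ j, |x j| * |y j| :=
  Finset.sum_le_sum fun j _ => by rw [← abs_mul]; exact le_abs_self _

theorem Superlin.bddAbove {g : Rn n → ℝ} (hg : Superlin g) (x : Rn n) :
    BddAbove (Set.range fun y : Rn n => ∑ j, x j * y j - g y) := by
  obtain ⟨C, hC⟩ := hg (∑ j, |x j|)
  refine ⟨C, ?_⟩
  rintro _ ⟨y, rfl⟩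
  have h : ∑ j, |x j| * |y j| ≤ (∑ j, |x j|) * ∑ j, |y j| := by
    rw [Finset.mul_sum]
    exact Finset.sum_le_sum fun j _ => mul_le_mul_of_nonneg_right
      (Finset.single_le_sum (f := fun j => |x j|) (fun i _ => abs_nonneg _) (Finset.mem_univ j))
      (abs_nonneg _)
  have := hC y
  have := sum_mul_le_abs x y
  simp only
  linarith

theorem Superlin.young {g : Rn n → ℝ} (hg : Superlin g) (x y : Rn n) :
    ∑ j, x j * y j - g y ≤ conjR g x := le_ciSup (hg.bddAbove x) y

theorem conjR_le {g : Rn n → ℝ} {x : Rn n} {c : ℝ} (h : ∀ y, ∑ j, x j * y j - g y ≤ c) :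
    conjR g x ≤ c := ciSup_le h

theorem Superlin.conj_coe {g : Rn n → ℝ} (hg : Superlin g) (x : Rn n) :
    conj (fun y => (g y : EReal)) x = (conjR g x : EReal) := by
  apply le_antisymm
  · refine iSup_le fun y => ?_
    rw [← EReal.coe_sub]
    exact EReal.coe_le_coe_iff.2 (hg.young x y)
  -- Testing against real `z` above the extended supremum reduces the claim to real upper bounds.
  · refine EReal.le_of_forall_lt_iff_le.1 fun z hz => ?_
    by_contra hlt
    have hlt' := not_le.1 hlt
    have : conjR g x ≤ z := conjR_le fun y => by
      have h1 : (((∑ j, x j * y j : ℝ) : EReal) - g y) ≤ conj (fun y => (g y : EReal)) x :=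
        le_iSup (fun y : Rn n => (((∑ j, x j * y j : ℝ) : EReal) - g y)) y
      rw [← EReal.coe_sub] at h1
      exact EReal.coe_le_coe_iff.1 (h1.trans hz.le)
    exact absurd (EReal.coe_le_coe_iff.2 this) hlt

/-- The vector with the moduli of the coordinates of `y` and the signs of those of `x`. -/
def signedVec (x y : Rn n) : Rn n := WithLp.toLp 2 fun j => if x j < 0 then -|y j| else |y j|

theorem sum_mul_signedVec (x y : Rn n) : ∑ j, x j * signedVec x y j = ∑ j, |x j| * |y j| := by
  refine Finset.sum_congr rfl fun j _ => ?_
  by_cases h : x j < 0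
  · simp [signedVec, h, abs_of_neg h]
  · simp [signedVec, h, abs_of_nonneg (not_lt.1 h)]

theorem absVec_signedVec (x y : Rn n) : absVec (signedVec x y) = absVec y := by
  ext j
  by_cases h : x j < 0 <;> simp [absVec, signedVec, h]

theorem absVec_absVec (y : Rn n) : absVec (absVec y) = absVec y := by
  ext j; simp [absVec]

theorem orthant_absVec (y : Rn n) : Orthant (absVec y) := fun _ => abs_nonneg _

theorem absVec_of_orthant {y : Rn n} (hy : Orthant y) : absVec y = y := by
  ext j; simp [absVec, abs_of_nonneg (hy j)]

theorem apply_signedVec {g : Rn n → ℝ} (he : ∀ x, g x = g (absVec x)) (x y : Rn n) :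
    g (signedVec x y) = g y := by
  rw [he, absVec_signedVec, ← he]

/-- Young's inequality for even functions. -/
theorem Superlin.young_abs {g : Rn n → ℝ} (hg : Superlin g) (he : ∀ x, g x = g (absVec x))
    (x y : Rn n) : ∑ j, |x j| * |y j| - g y ≤ conjR g x := by
  have := hg.young x (signedVec x y)
  rwa [sum_mul_signedVec, apply_signedVec he] at this

/-- For even `g` the signs of `y` can be aligned with those of `x'`, so only the moduli of the
coordinates matter. Both parity and monotonicity of `h_ν` follow. -/
theorem conjR_mono_abs {g : Rn n → ℝ} (hg : Superlin g) (he : ∀ x, g x = g (absVec x))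
    {x x' : Rn n} (h : ∀ j, |x j| ≤ |x' j|) : conjR g x ≤ conjR g x' := by
  refine conjR_le fun y => le_trans ?_ (hg.young_abs he x' y)
  have := sum_mul_le_abs x y
  have : ∑ j, |x j| * |y j| ≤ ∑ j, |x' j| * |y j| :=
    Finset.sum_le_sum fun j _ => mul_le_mul_of_nonneg_right (h j) (abs_nonneg _)
  linarith

theorem conjR_even {g : Rn n → ℝ} (hg : Superlin g) (he : ∀ x, g x = g (absVec x)) (x : Rn n) :
    conjR g x = conjR g (absVec x) :=
  le_antisymm (conjR_mono_abs hg he fun j => by simp [absVec])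
    (conjR_mono_abs hg he fun j => by simp [absVec])

theorem conjR_convexOn {g : Rn n → ℝ} (hg : Superlin g) : ConvexOn ℝ Set.univ (conjR g) := by
  refine ⟨convex_univ, fun x _ x' _ a b ha hb hab => conjR_le fun y => ?_⟩
  have h1 := mul_le_mul_of_nonneg_left (hg.young x y) ha
  have h2 := mul_le_mul_of_nonneg_left (hg.young x' y) hb
  have h3 : ∑ j, (a • x + b • x') j * y j = a * ∑ j, x j * y j + b * ∑ j, x' j * y j := by
    rw [Finset.mul_sum, Finset.mul_sum, ← Finset.sum_add_distrib]
    refine Finset.sum_congr rfl fun j _ => ?_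
    simp only [PiLp.add_apply, PiLp.smul_apply, smul_eq_mul]
    ring
  have h4 : g y = a * g y + b * g y := by rw [← add_mul, hab, one_mul]
  rw [h3, h4, smul_eq_mul, smul_eq_mul]
  linarith

/-- The vector all of whose coordinates equal `R`. -/
def constVec (n : ℕ) (R : ℝ) : Rn n := WithLp.toLp 2 fun _ => R

theorem conjR_superlin {g : Rn n → ℝ} (hg : Superlin g) (he : ∀ x, g x = g (absVec x)) :
    Superlin (conjR g) := by
  intro K
  refine ⟨g (constVec n K), fun x => ?_⟩
  have h1 := hg.young_abs he x (constVec n K)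
  have h2 : K * ∑ j, |x j| ≤ ∑ j, |x j| * |constVec n K j| := by
    rw [Finset.mul_sum]
    refine Finset.sum_le_sum fun j _ => ?_
    rw [mul_comm]
    exact mul_le_mul_of_nonneg_left (le_abs_self K) (abs_nonneg _)
  linarith

/-- An approximate supporting functional, with coordinates in `[0, ∞)`. -/
theorem exists_approx_subgradient {g : Rn n → ℝ} (hg : Superlin g)
    (he : ∀ x, g x = g (absVec x)) (hc : ConvexOn ℝ Set.univ g) (x : Rn n) (hx : Orthant x) :
    ∃ ξ : Rn n, Orthant ξ ∧ g x - 1 ≤ ∑ j, ξ j * x j - conjR g ξ := by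
  -- An affine minorant through the point `(x, g x - 1)`, strictly below the graph; this is where
  -- the loss of 1 arises.
  obtain ⟨l, c, h1, h2⟩ := hc.exists_affine_le_of_lt (𝕜 := ℝ) (Set.mem_univ x)
    (sub_one_lt (g x)) isClosed_univ
    (hc.locallyLipschitz.continuous.lowerSemicontinuous.lowerSemicontinuousOn _)
  have h1' : ∀ y, l y + c ≤ g y := fun y => by simpa using h1 ⟨y, Set.mem_univ y⟩
  set ξ : Rn n := WithLp.toLp 2 fun j => l (EuclideanSpace.single j 1)
  have hl : ∀ y, l y = ∑ j, ξ j * y j := fun y => by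
    conv_lhs => rw [← (EuclideanSpace.basisFun (Fin n) ℝ).sum_repr y]
    simp [ξ, map_sum, mul_comm]
  have h2' : l x + c = g x - 1 := by simpa using h2
  -- Passing to moduli keeps the conjugate, which is even, and can only raise the pairing with `x ≥
  -- 0`.
  refine ⟨absVec ξ, orthant_absVec ξ, ?_⟩
  rw [← conjR_even hg he]
  have h3 : conjR g ξ ≤ -c := conjR_le fun y => by
    have := h1' y
    rw [hl] at this
    linarith
  have h4 : ∑ j, ξ j * x j ≤ ∑ j, absVec ξ j * x j :=
    Finset.sum_le_sum fun j _ => mul_le_mul_of_nonneg_right (le_abs_self _) (hx j)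
  rw [hl] at h2'
  linarith

theorem sum_abs_le (x : Rn n) : ∑ j, |x j| ≤ n * ‖x‖ := by
  calc ∑ j, |x j| ≤ ∑ _j : Fin n, ‖x‖ := Finset.sum_le_sum fun j _ => PiLp.norm_apply_le x j
    _ = n * ‖x‖ := by simp

theorem norm_le_sum_abs (x : Rn n) : ‖x‖ ≤ ∑ j, |x j| := by
  conv_lhs => rw [← (EuclideanSpace.basisFun (Fin n) ℝ).sum_repr x]
  refine (norm_sum_le _ _).trans (Finset.sum_le_sum fun j _ => ?_)
  simp [norm_smul]

theorem Superlin.tendsto {g : Rn n → ℝ} (hg : Superlin g) :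
    Tendsto (fun x => g x / ‖x‖) (Bornology.cobounded (Rn n)) atTop := by
  refine tendsto_atTop.2 fun K => ?_
  obtain ⟨C, hC⟩ := hg (|K| + 1)
  filter_upwards [tendsto_norm_cobounded_atTop.eventually (eventually_ge_atTop (max C 1))]
    with x hx
  have h1 : 1 ≤ ‖x‖ := (le_max_right _ _).trans hx
  have h2 : C ≤ ‖x‖ := (le_max_left _ _).trans hx
  rw [le_div_iff₀ (by linarith)]
  have h3 := mul_le_mul_of_nonneg_left (norm_le_sum_abs x) (by positivity : (0 : ℝ) ≤ |K| + 1)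
  have h4 := mul_le_mul_of_nonneg_right (le_abs_self K) (norm_nonneg x)
  linarith [hC x]

/-- The limit controls `g` outside a ball; inside it `∑ |y_j|` is bounded and the lower bound `m`
suffices. -/
theorem Superlin.of_tendsto {g : Rn n → ℝ} {m : ℝ} (hm : ∀ x, m ≤ g x)
    (hg : Tendsto (fun x => g x / ‖x‖) (Bornology.cobounded (Rn n)) atTop) : Superlin g := by
  intro K
  have h := tendsto_atTop.1 hg (|K| * n)
  rw [Filter.hasBasis_cobounded_norm.eventually_iff] at h
  obtain ⟨R, -, hR⟩ := h
  refine ⟨|K| * (n * max R 0) - min m 0, fun y => ?_⟩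
  have h1 : K * ∑ j, |y j| ≤ |K| * (n * ‖y‖) :=
    (mul_le_mul_of_nonneg_right (le_abs_self K) (Finset.sum_nonneg fun j _ => abs_nonneg _)).trans
      (mul_le_mul_of_nonneg_left (sum_abs_le y) (abs_nonneg K))
  rcases le_or_gt ‖y‖ (max R 0) with hy | hy
  · have : |K| * (n * ‖y‖) ≤ |K| * (n * max R 0) := by gcongr
    linarith [hm y, min_le_left m 0]
  · have h2 := hR (show y ∈ {x : Rn n | R ≤ ‖x‖} from (le_max_left R 0).trans hy.le)
    rw [le_div_iff₀ ((le_max_right R 0).trans_lt hy)] at h2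
    have : 0 ≤ |K| * (n * max R 0) := by positivity
    linarith [min_le_right m 0]

end Conjugate

/-! ### The weights `h_ν` -/

section ConjWeight

variable {n : ℕ}

/-- The function `ψ = M*[e](|·|)` with real values. -/
def psiR (M : Rn n → ℝ) (y : Rn n) : ℝ := conjR M (expVec (absVec y))

theorem psi_eq_coe {M : Rn n → ℝ} (hM : Superlin M) : psi M = fun y => (psiR M y : EReal) :=
  funext fun _ => hM.conj_coe _

theorem psiR_even (M : Rn n → ℝ) (y : Rn n) : psiR M y = psiR M (absVec y) := by
  rw [psiR, psiR, absVec_absVec]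

/-- Young's inequality for `M` tested at `(K, …, K)`. It yields both the superlinearity of `ψ` and
condition 4). -/
theorem le_psiR {M : Rn n → ℝ} (hM : Superlin M) (K : ℝ) (y : Rn n) :
    K * ∑ j, Real.exp |y j| - M (constVec n K) ≤ psiR M y := by
  have h := hM.young (expVec (absVec y)) (constVec n K)
  rw [Finset.mul_sum]
  simpa [expVec, absVec, constVec, mul_comm, psiR] using h

theorem psiR_superlin {M : Rn n → ℝ} (hM : Superlin M) : Superlin (psiR M) := by
  intro K
  refine ⟨M (constVec n |K|), fun y => le_trans ?_ (le_psiR hM |K| y)⟩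
  have h1 : ∑ j, |y j| ≤ ∑ j, Real.exp |y j| := Finset.sum_le_sum fun j _ =>
    (le_add_of_nonneg_right zero_le_one).trans (Real.add_one_le_exp _)
  have h2 : K * ∑ j, |y j| ≤ |K| * ∑ j, Real.exp |y j| :=
    (mul_le_mul_of_nonneg_right (le_abs_self K) (Finset.sum_nonneg fun j _ => abs_nonneg _)).trans
      (mul_le_mul_of_nonneg_left h1 (abs_nonneg K))
  linarith

theorem isConjWeight_conjR {M : Rn n → ℝ} (hM : Superlin M) :
    IsConjWeight M (conjR (psiR M)) := fun x => by
  rw [psi_eq_coe hM, (psiR_superlin hM).conj_coe]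

/-- The maximum of `x y - K e^y` is at `y = log (x / K)`, with value `x log (x / K) - x`; the term
`-x` is dropped. -/
theorem mul_sub_mul_exp_le {x K : ℝ} (hx : 0 ≤ x) (hK : 0 < K) (y : ℝ) :
    x * y - K * Real.exp |y| ≤ x * Real.log (x / K) := by
  have h0 : K * Real.exp y ≤ K * Real.exp |y| :=
    mul_le_mul_of_nonneg_left (Real.exp_le_exp.2 (le_abs_self y)) hK.le
  rcases hx.eq_or_lt with rfl | hx
  · simpa using (by positivity : 0 ≤ K * Real.exp |y|)
  · have h1 : K * Real.exp y = x * Real.exp (y - Real.log (x / K)) := by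
      rw [Real.exp_sub, Real.exp_log (by positivity)]
      field_simp
    have h2 := mul_le_mul_of_nonneg_left (Real.add_one_le_exp (y - Real.log (x / K))) hx.le
    nlinarith

theorem conjR_psiR_le {M : Rn n → ℝ} (hM : Superlin M) {K : ℝ} (hK : 0 < K) {x : Rn n}
    (hx : Orthant x) :
    conjR (psiR M) x ≤ ∑ j, x j * Real.log (x j / K) + M (constVec n K) := by
  refine conjR_le fun y => ?_
  have h1 := le_psiR hM K y
  have h2 : ∑ j, x j * y j - K * ∑ j, Real.exp |y j| ≤ ∑ j, x j * Real.log (x j / K) := by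
    rw [Finset.mul_sum, ← Finset.sum_sub_distrib]
    exact Finset.sum_le_sum fun j _ => mul_sub_mul_exp_le (hx j) hK (y j)
  linarith

/-- Conjugation turns `N(2x) ≤ M(x) + A` into `M*(2ξ) ≤ N*(ξ) + A`. -/
theorem conjR_two_smul_le {M N : Rn n → ℝ} (hN : Superlin N) {A : ℝ}
    (h : ∀ x, N ((2 : ℝ) • x) ≤ M x + A) (ξ : Rn n) :
    conjR M ((2 : ℝ) • ξ) ≤ conjR N ξ + A := by
  refine conjR_le fun y => ?_
  have h1 := hN.young ξ ((2 : ℝ) • y)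
  have h2 : ∑ j, ((2 : ℝ) • ξ) j * y j = ∑ j, ξ j * ((2 : ℝ) • y) j :=
    Finset.sum_congr rfl fun j _ => by
      simp only [PiLp.smul_apply, smul_eq_mul]
      ring
  linarith [h y]

/-- Raising every `|y_j|` by `log 2` doubles `e^{|y_j|}`, which the conjugate doubling inequality
absorbs, while the pairing with `x` gains `log 2 · ∑ x_j`. -/
theorem conjR_psiR_gap {M N : Rn n → ℝ} (hM : Superlin M) (hN : Superlin N) {A : ℝ}
    (h : ∀ x, N ((2 : ℝ) • x) ≤ M x + A) {x : Rn n} (hx : Orthant x) :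
    conjR (psiR N) x ≤ conjR (psiR M) x - Real.log 2 * ∑ j, x j + A := by
  refine conjR_le fun y => ?_
  set z : Rn n := WithLp.toLp 2 fun j => |y j| + Real.log 2 with hz
  have hl : 0 ≤ Real.log 2 := Real.log_nonneg one_le_two
  have h1 : expVec (absVec z) = (2 : ℝ) • expVec (absVec y) := by
    ext j
    have : 0 ≤ |y j| + Real.log 2 := by positivity
    simp only [expVec, absVec, hz, abs_of_nonneg this, PiLp.smul_apply, smul_eq_mul]
    rw [Real.exp_add, Real.exp_log two_pos, mul_comm]
  have h2 : psiR M z ≤ psiR N y + A := by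
    rw [psiR, h1]
    exact conjR_two_smul_le hN h _
  have h3 := (psiR_superlin hM).young x z
  have h4 : ∑ j, x j * z j = ∑ j, x j * |y j| + Real.log 2 * ∑ j, x j := by
    rw [Finset.mul_sum, ← Finset.sum_add_distrib]
    exact Finset.sum_congr rfl fun j _ => by simp only [hz]; ring
  have h5 : ∑ j, x j * y j ≤ ∑ j, x j * |y j| :=
    Finset.sum_le_sum fun j _ => mul_le_mul_of_nonneg_left (le_abs_self _) (hx j)
  linarith

theorem conjR_le_half {M : Rn n → ℝ} (hM : Superlin M) (ξ η : Rn n) :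
    conjR M (ξ + η) ≤ (conjR M ((2 : ℝ) • ξ) + conjR M ((2 : ℝ) • η)) / 2 := by
  have h := (conjR_convexOn hM).2 (Set.mem_univ ((2 : ℝ) • ξ)) (Set.mem_univ ((2 : ℝ) • η))
    (by norm_num : (0 : ℝ) ≤ 1 / 2) (by norm_num : (0 : ℝ) ≤ 1 / 2) (by norm_num)
  have h1 : (1 / 2 : ℝ) • (2 : ℝ) • ξ + (1 / 2 : ℝ) • (2 : ℝ) • η = ξ + η := by
    rw [smul_smul, smul_smul]; norm_num
  rw [h1, smul_eq_mul, smul_eq_mul] at h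
  linarith

/-- Convexity of `M*` between `0` and `2ξ`, followed by the conjugate doubling inequality, gives `2
ψ_M ≤ ψ_N + M*(0) + A`. Hence two Young inequalities for `ψ_M` can be added at the same point `t`.
-/
theorem conjR_psiR_add_le {M N : Rn n → ℝ} (hM : Superlin M) (hN : Superlin N) {A : ℝ}
    (h : ∀ x, N ((2 : ℝ) • x) ≤ M x + A) (x y : Rn n) :
    conjR (psiR N) (x + y) ≤ conjR (psiR M) x + conjR (psiR M) y + (conjR M 0 + A) := by
  refine conjR_le fun t => ?_
  have h1 := (psiR_superlin hM).young x t
  have h2 := (psiR_superlin hM).young y t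
  have h3 := conjR_le_half hM (expVec (absVec t)) 0
  rw [add_zero, smul_zero] at h3
  have h4 := conjR_two_smul_le hN h (expVec (absVec t))
  have h5 : ∑ j, (x + y) j * t j = ∑ j, x j * t j + ∑ j, y j * t j := by
    rw [← Finset.sum_add_distrib]
    exact Finset.sum_congr rfl fun j _ => by rw [PiLp.add_apply, add_mul]
  unfold psiR at *
  linarith

theorem IsGSFamily.apply_zero_le {M : ℕ → Rn n → ℝ} (hM : IsGSFamily M) (ν : ℕ) (x : Rn n) :
    M ν 0 ≤ M ν x := by
  rw [hM.even ν x]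
  exact hM.mono ν _ _ (fun _ => le_rfl) (orthant_absVec x) (orthant_absVec x)

theorem IsGSFamily.superlin {M : ℕ → Rn n → ℝ} (hM : IsGSFamily M) (ν : ℕ) : Superlin (M ν) :=
  Superlin.of_tendsto (hM.apply_zero_le ν) (hM.superlinear ν)

theorem IsGSFamily.isHFamily {M : ℕ → Rn n → ℝ} (hM : IsGSFamily M) :
    IsHFamily fun ν => conjR (psiR (M ν)) where
  convex ν := conjR_convexOn (psiR_superlin (hM.superlin ν))
  even ν := conjR_even (psiR_superlin (hM.superlin ν)) (psiR_even _)
  mono ν x y hx hy h := conjR_mono_abs (psiR_superlin (hM.superlin ν)) (psiR_even _) fun j => by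
    rw [abs_of_nonneg (hx j), abs_of_nonneg (hy j)]; exact h j
  superlinear ν := (conjR_superlin (psiR_superlin (hM.superlin ν)) (psiR_even _)).tendsto
  upper ν K hK := ⟨|M ν (constVec n K)| + 1, by positivity, fun x hx => by
    linarith [conjR_psiR_le (hM.superlin ν) hK hx, le_abs_self (M ν (constVec n K))]⟩
  gap ν := by
    obtain ⟨A, -, hA⟩ := hM.doubling ν
    exact ⟨A, fun x hx => by
      linarith [conjR_psiR_gap (hM.superlin ν) (hM.superlin (ν + 1)) hA hx]⟩
  subadd ν := by
    obtain ⟨A, -, hA⟩ := hM.doubling ν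
    exact ⟨_, fun x y _ _ => conjR_psiR_add_le (hM.superlin ν) (hM.superlin (ν + 1)) hA x y⟩

end ConjWeight

/-! ### Comparison of weighted spaces and of inductive limits -/

section Comparison

/-- The index `k` may depend on the point `x` as well as on `i`: in the lower estimate the
multi-index is chosen according to `x`. -/
theorem quot_le_of_weight_le {n : ℕ} {ι κ : Type} {w : ι → Rn n → ℝ} {v : κ → Rn n → ℝ} {C : ℝ}
    (h : ∀ i x, ∃ k, |v i x| ≤ C * |w k x|) {m : ℕ} {f : Rn n → ℂ}
    (p : κ × {α : Fin n → ℕ // ∑ j, α j ≤ m} × Rn n) : ∃ q, quot v m f p ≤ C * quot w m f q := by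
  obtain ⟨k, hk⟩ := h p.1 p.2.2
  refine ⟨(k, p.2), ?_⟩
  unfold quot
  rw [← mul_assoc]
  exact mul_le_mul_of_nonneg_right hk (norm_nonneg _)

theorem weightedSpace_le_of_weight_le {n : ℕ} {ι κ : Type} {w : ι → Rn n → ℝ}
    {v : κ → Rn n → ℝ} {C : ℝ} (hC : 0 ≤ C) (h : ∀ i x, ∃ k, |v i x| ≤ C * |w k x|) :
    weightedSpace w ≤ weightedSpace v := by
  intro f hf
  rw [mem_weightedSpace] at hf ⊢
  intro m
  obtain ⟨h1, A, hA⟩ := hf m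
  refine ⟨h1, C * A, ?_⟩
  rintro _ ⟨p, rfl⟩
  obtain ⟨q, hq⟩ := quot_le_of_weight_le h (f := f) p
  exact hq.trans (mul_le_mul_of_nonneg_left (hA ⟨q, rfl⟩) hC)

theorem withSeminorms_weightedNorm {n : ℕ} {ι : Type} (w : ι → Rn n → ℝ) :
    @WithSeminorms ℂ (weightedSpace w) ℕ _ _ _ (weightedNorm w) (weightedTopology w) :=
  letI := weightedTopology w
  ⟨rfl⟩

theorem continuous_inclusion_of_weight_le {n : ℕ} {ι κ : Type} {w : ι → Rn n → ℝ}
    {v : κ → Rn n → ℝ} {C : ℝ} (hC : 0 ≤ C) (h : ∀ i x, ∃ k, |v i x| ≤ C * |w k x|) :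
    @Continuous _ _ (weightedTopology w) (weightedTopology v)
      (Submodule.inclusion (weightedSpace_le_of_weight_le hC h)) := by
  refine (withSeminorms_weightedNorm w).continuous_of_isBounded (withSeminorms_weightedNorm v)
    (Submodule.inclusion (weightedSpace_le_of_weight_le hC h)) ?_
  refine Seminorm.IsBounded.of_real fun m => ⟨{m}, C, fun f => ?_⟩
  rw [Finset.sup_singleton]
  have hf := (mem_weightedSpace.1 f.2 m).2
  refine Real.iSup_le (fun p => ?_) (mul_nonneg hC (apply_nonneg _ _))
  obtain ⟨q, hq⟩ := quot_le_of_weight_le h (f := (f : Rn n → ℂ)) p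
  exact hq.trans (mul_le_mul_of_nonneg_left (le_ciSup hf q) hC)

/-- `S` is contained in `T`, with continuous inclusion. -/
def ContLE {V : Type} [AddCommGroup V] [Module ℂ V] (S T : Submodule ℂ V)
    (τ : TopologicalSpace S) (σ : TopologicalSpace T) : Prop :=
  ∃ h : S ≤ T, @Continuous S T τ σ (Submodule.inclusion h)

theorem contLE_of_weight_le {n : ℕ} {ι κ : Type} {w : ι → Rn n → ℝ}
    {v : κ → Rn n → ℝ} {C : ℝ} (hC : 0 ≤ C) (h : ∀ i x, ∃ k, |v i x| ≤ C * |w k x|) :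
    ContLE (weightedSpace w) (weightedSpace v) (weightedTopology w) (weightedTopology v) :=
  ⟨_, continuous_inclusion_of_weight_le hC h⟩

variable {V : Type} [AddCommGroup V] [Module ℂ V]

theorem unionSpace_le {κ κ' : Type} [Nonempty κ] [Nonempty κ'] {S : κ → Submodule ℂ V}
    {T : κ' → Submodule ℂ V} {hS : Directed (· ≤ ·) S} {hT : Directed (· ≤ ·) T}
    (h : ∀ k, ∃ l, S k ≤ T l) : unionSpace S hS ≤ unionSpace T hT := by
  intro f hf
  obtain ⟨k, hk⟩ := Set.mem_iUnion.1 hf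
  obtain ⟨l, hl⟩ := h k
  exact Set.mem_iUnion.2 ⟨l, hl hk⟩

/-- The inclusion of `S k` factors through some `T l`. -/
theorem continuous_inclusion_of_contLE {κ κ' : Type} {S : κ → Submodule ℂ V}
    {T : κ' → Submodule ℂ V} {τ : ∀ k, TopologicalSpace (S k)}
    {σ : ∀ l, TopologicalSpace (T l)} (h : ∀ k, ∃ l, ContLE (S k) (T l) (τ k) (σ l))
    {U : Submodule ℂ V} (hS : ∀ k, S k ≤ U) (hT : ∀ l, T l ≤ U) (t : TopologicalSpace U)
    (ht : ∀ l, @Continuous _ _ (σ l) t (Submodule.inclusion (hT l))) (k : κ) :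
    @Continuous _ _ (τ k) t (Submodule.inclusion (hS k)) := by
  obtain ⟨l, hle, hc⟩ := h k
  exact @Continuous.comp _ _ _ (τ k) (σ l) t _ _ (ht l) hc

/-- Once the unions are identified, the two sets of admissible topologies coincide, hence so do
their infima. Arbitrary `U` and `U'` are used so that the equality `e` can be substituted. -/
theorem isHomeomorph_ofEq {κ κ' : Type} {S : κ → Submodule ℂ V}
    {T : κ' → Submodule ℂ V} {τ : ∀ k, TopologicalSpace (S k)}
    {σ : ∀ l, TopologicalSpace (T l)} (h1 : ∀ k, ∃ l, ContLE (S k) (T l) (τ k) (σ l))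
    (h2 : ∀ l, ∃ k, ContLE (T l) (S k) (σ l) (τ k))
    {U U' : Submodule ℂ V} (e : U = U') (hS : ∀ k, S k ≤ U) (hT : ∀ l, T l ≤ U') :
    @IsHomeomorph U U'
      (sInf {t : TopologicalSpace U |
        @IsTopologicalAddGroup _ t _ ∧ @ContinuousSMul ℂ _ _ _ t ∧
        @LocallyConvexSpace ℝ _ _ _ _ _ t ∧
        ∀ k, @Continuous _ _ (τ k) t (Submodule.inclusion (hS k))})
      (sInf {t : TopologicalSpace U' |
        @IsTopologicalAddGroup _ t _ ∧ @ContinuousSMul ℂ _ _ _ t ∧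
        @LocallyConvexSpace ℝ _ _ _ _ _ t ∧
        ∀ l, @Continuous _ _ (σ l) t (Submodule.inclusion (hT l))})
      (LinearEquiv.ofEq U U' e) := by
  subst e
  have hset : ∀ t : TopologicalSpace U,
      (∀ k, @Continuous _ _ (τ k) t (Submodule.inclusion (hS k))) ↔
        ∀ l, @Continuous _ _ (σ l) t (Submodule.inclusion (hT l)) := fun t =>
    ⟨fun ht => continuous_inclusion_of_contLE h2 hT hS t ht,
      fun ht => continuous_inclusion_of_contLE h1 hS hT t ht⟩
  rw [show {t : TopologicalSpace U | @IsTopologicalAddGroup _ t _ ∧ @ContinuousSMul ℂ _ _ _ t ∧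
        @LocallyConvexSpace ℝ _ _ _ _ _ t ∧
        ∀ k, @Continuous _ _ (τ k) t (Submodule.inclusion (hS k))} =
      {t : TopologicalSpace U | @IsTopologicalAddGroup _ t _ ∧ @ContinuousSMul ℂ _ _ _ t ∧
        @LocallyConvexSpace ℝ _ _ _ _ _ t ∧
        ∀ l, @Continuous _ _ (σ l) t (Submodule.inclusion (hT l))} from
    Set.ext fun t => and_congr_right' (and_congr_right' (and_congr_right' (hset t)))]
  exact @IsHomeomorph.id _ (_)

/-- Two inductive families that are mutually cofinal by continuous inclusions have the same
inductive limit. -/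
theorem eqTop_indLimTopology {κ κ' : Type} [Nonempty κ] [Nonempty κ'] {S : κ → Submodule ℂ V}
    {T : κ' → Submodule ℂ V} {hS : Directed (· ≤ ·) S} {hT : Directed (· ≤ ·) T}
    {τ : ∀ k, TopologicalSpace (S k)} {σ : ∀ l, TopologicalSpace (T l)}
    (h1 : ∀ k, ∃ l, ContLE (S k) (T l) (τ k) (σ l))
    (h2 : ∀ l, ∃ k, ContLE (T l) (S k) (σ l) (τ k)) :
    EqTop (unionSpace S hS) (unionSpace T hT) (indLimTopology S hS τ) (indLimTopology T hT σ) :=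
  ⟨le_antisymm (unionSpace_le fun k => (h1 k).imp fun _ h => h.1)
    (unionSpace_le fun l => (h2 l).imp fun _ h => h.1),
    isHomeomorph_ofEq h1 h2 _ (le_unionSpace S hS) (le_unionSpace T hT)⟩

theorem ContLE.trans {S T U : Submodule ℂ V} {τ : TopologicalSpace S} {σ : TopologicalSpace T}
    {ρ : TopologicalSpace U} (h1 : ContLE S T τ σ) (h2 : ContLE T U σ ρ) : ContLE S U τ ρ :=
  ⟨h1.1.trans h2.1, @Continuous.comp _ _ _ τ σ ρ _ _ h2.2 h1.2⟩

end Comparison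

/-! ### Comparison of the weights of `GS(𝓜)` and `G(𝓗)` -/

section Weights

variable {n : ℕ}

theorem abs_gsWeight (M : Rn n → ℝ) (i : Unit) (x : Rn n) : |gsWeight M i x| = Real.exp (M x) := by
  rw [gsWeight, Real.exp_neg, one_div, inv_inv, abs_of_pos (Real.exp_pos _)]

theorem abs_gWeight (h : Rn n → ℝ) (β : Fin n → ℕ) (x : Rn n) :
    |gWeight h β x| = (∏ j, |x j| ^ β j / ((β j)! : ℝ)) * Real.exp (h (natVec β)) := by
  rw [gWeight, ← div_div, Real.exp_neg, div_inv_eq_mul, abs_mul, abs_of_pos (Real.exp_pos _),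
    ← Finset.prod_div_distrib, Finset.abs_prod]
  congr 1
  refine Finset.prod_congr rfl fun j _ => ?_
  rw [abs_div, abs_pow, Nat.abs_cast]

theorem prod_mul_exp_pow_div (x u : Fin n → ℝ) (β : Fin n → ℕ) :
    ∏ j, (x j * Real.exp (u j)) ^ β j / ((β j)! : ℝ)
      = (∏ j, x j ^ β j / ((β j)! : ℝ)) * Real.exp (∑ j, (β j : ℝ) * u j) := by
  rw [Real.exp_sum, ← Finset.prod_mul_distrib]
  refine Finset.prod_congr rfl fun j _ => ?_
  rw [mul_pow, ← Real.exp_nat_mul, mul_div_right_comm]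

theorem abs_gWeight_le {M : Rn n → ℝ} (hM : Superlin M) (he : ∀ x, M x = M (absVec x))
    (β : Fin n → ℕ) (x : Rn n) :
    |gWeight (conjR (psiR M)) β x| ≤ Real.exp (M x) := by
  rw [abs_gWeight]
  set a := ∏ j, |x j| ^ β j / ((β j)! : ℝ) with ha
  have ha0 : 0 ≤ a := Finset.prod_nonneg fun j _ => by positivity
  -- A vanishing monomial has no logarithm, but then the weight itself is zero.
  rcases ha0.eq_or_lt with h0 | h0
  · rw [← h0, zero_mul]; positivity
  have key : conjR (psiR M) (natVec β) ≤ M x - Real.log a := by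
    refine conjR_le fun u => ?_
    have h1 : a * Real.exp (∑ j, (β j : ℝ) * |u j|) ≤ Real.exp (∑ j, |x j| * Real.exp |u j|) := by
      rw [ha, ← prod_mul_exp_pow_div (fun j => |x j|) (fun j => |u j|), Real.exp_sum]
      exact Finset.prod_le_prod (fun j _ => by positivity) fun j _ =>
        Real.pow_div_factorial_le_exp _ (by positivity) _
    have h2 : ∑ j, |x j| * Real.exp |u j| - M x ≤ psiR M u := by
      have := hM.young_abs he (expVec (absVec u)) x
      simpa [expVec, absVec, mul_comm, psiR] using this
    have h3 : Real.log a + ∑ j, (β j : ℝ) * |u j| ≤ ∑ j, |x j| * Real.exp |u j| := by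
      rw [← Real.exp_le_exp, Real.exp_add, Real.exp_log h0]
      exact h1
    have h4 : ∑ j, natVec β j * u j ≤ ∑ j, (β j : ℝ) * |u j| :=
      Finset.sum_le_sum fun j _ => mul_le_mul_of_nonneg_left (le_abs_self _) (Nat.cast_nonneg _)
    linarith
  calc a * Real.exp (conjR (psiR M) (natVec β))
      = Real.exp (Real.log a + conjR (psiR M) (natVec β)) := by rw [Real.exp_add, Real.exp_log h0]
    _ ≤ Real.exp (M x) := Real.exp_le_exp.2 (by linarith)

/-- Pigeonhole: `e^{s/2}` is the sum of `s^k / k!` with weights `2^{-k}` of total mass 2, so the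
terms cannot all lie below `e^{s/2} / 3`. Any constant above 2 would serve. -/
theorem exists_exp_half_le (s : ℝ) :
    ∃ k : ℕ, Real.exp (s / 2) ≤ 3 * (s ^ k / (k ! : ℝ)) := by
  by_contra! h
  have h1 : HasSum (fun k : ℕ => (s / 2) ^ k / (k ! : ℝ)) (Real.exp (s / 2)) := by
    rw [Real.exp_eq_exp_ℝ]
    exact NormedSpace.expSeries_div_hasSum_exp (s / 2)
  have h2 : HasSum (fun k : ℕ => Real.exp (s / 2) / 3 * (1 / 2 : ℝ) ^ k)
      (Real.exp (s / 2) / 3 * 2) := hasSum_geometric_two.mul_left _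
  have h3 := hasSum_le (fun k => ?_) h1 h2
  · linarith [Real.exp_pos (s / 2)]
  · have : (s / 2) ^ k / (k ! : ℝ) = s ^ k / (k ! : ℝ) * (1 / 2 : ℝ) ^ k := by
      rw [div_pow, one_div, inv_pow]; ring
    rw [this]
    exact mul_le_mul_of_nonneg_right (by linarith [h k]) (by positivity)

/-- The shift by `(1, …, 1)` makes `log (ξ_j + 1)` nonnegative in the lower estimate; by convexity
and doubling it costs only a constant. -/
theorem conjR_add_one_le {M N : Rn n → ℝ} (hM : Superlin M) (hN : Superlin N) {A : ℝ}
    (h : ∀ x, N ((2 : ℝ) • x) ≤ M x + A) (ξ : Rn n) :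
    conjR M (ξ + constVec n 1) ≤
      conjR N ξ + (A + (conjR M ((2 : ℝ) • constVec n 1) + M 0) / 2) := by
  have h1 := conjR_le_half hM ξ (constVec n 1)
  have h2 := conjR_two_smul_le hN h ξ
  -- Since `M*(2ξ) ≥ -M(0)`, half of `M*(2ξ)` is at most the whole plus `M(0) / 2`.
  have h3 := hM.young ((2 : ℝ) • ξ) 0
  simp only [PiLp.zero_apply, mul_zero, Finset.sum_const_zero, zero_sub] at h3
  linarith

theorem exists_exp_le_abs_gWeight {M N : Rn n → ℝ} (hM : Superlin M) (hN : Superlin N)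
    (heN : ∀ x, N x = N (absVec x)) (hcN : ConvexOn ℝ Set.univ N)
    {A : ℝ} (h : ∀ x, N ((2 : ℝ) • x) ≤ M x + A) :
    ∃ C : ℝ, 0 ≤ C ∧ ∀ x, ∃ β,
      Real.exp (N ((1 / 2 : ℝ) • absVec x)) ≤ C * |gWeight (conjR (psiR M)) β x| := by
  set B := A + (conjR M ((2 : ℝ) • constVec n 1) + M 0) / 2 with hB
  -- One factor 3 per coordinate from the choice of `β_j`, a factor `e` from the approximate
  -- subgradient, and `e^B` from the shift of `ξ`.
  refine ⟨3 ^ n * Real.exp (1 + B), by positivity, fun x => ?_⟩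
  obtain ⟨ξ, hξ, hsub⟩ := exists_approx_subgradient hN heN hcN ((1 / 2 : ℝ) • absVec x) fun j => by
    simp only [PiLp.smul_apply, smul_eq_mul]
    exact mul_nonneg (by norm_num) (orthant_absVec x j)
  have hpos : ∀ j, 0 < ξ j + 1 := fun j => by linarith [hξ j]
  set u : Rn n := WithLp.toLp 2 fun j => Real.log (ξ j + 1) with hu
  have hu0 : Orthant u := fun j => Real.log_nonneg (by linarith [hξ j])
  have hexp : expVec (absVec u) = ξ + constVec n 1 := by
    rw [absVec_of_orthant hu0]
    ext j
    simp [expVec, hu, constVec, Real.exp_log (hpos j)]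
  choose β hβ using fun j => exists_exp_half_le (|x j| * Real.exp (u j))
  refine ⟨β, ?_⟩
  have h1 : Real.exp (∑ j, |x j| * Real.exp (u j) / 2) ≤
      3 ^ n * ((∏ j, |x j| ^ β j / ((β j)! : ℝ)) * Real.exp (∑ j, (β j : ℝ) * u j)) := by
    rw [← prod_mul_exp_pow_div (fun j => |x j|) (fun j => u j), Real.exp_sum]
    calc _ ≤ ∏ j, 3 * ((|x j| * Real.exp (u j)) ^ β j / ((β j)! : ℝ)) :=
          Finset.prod_le_prod (fun j _ => (Real.exp_pos _).le) fun j _ => hβ j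
      _ = _ := by rw [Finset.prod_mul_distrib]; simp
  have h2 : ∑ j, (β j : ℝ) * u j ≤ conjR (psiR M) (natVec β) + (conjR N ξ + B) := by
    have h3 := (psiR_superlin hM).young (natVec β) u
    have h4 := conjR_add_one_le hM hN h ξ
    rw [psiR, hexp] at h3
    simp only [natVec] at h3 ⊢
    linarith
  -- The half in `e^{s/2}` is the reason for taking the subgradient at `|x| / 2`.
  have h5 : ∑ j, ξ j * ((1 / 2 : ℝ) • absVec x) j ≤ ∑ j, |x j| * Real.exp (u j) / 2 := by
    refine Finset.sum_le_sum fun j _ => ?_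
    simp only [hu, Real.exp_log (hpos j), PiLp.smul_apply, smul_eq_mul, absVec]
    linarith [abs_nonneg (x j)]
  rw [abs_gWeight]
  set a := ∏ j, |x j| ^ β j / ((β j)! : ℝ) with ha
  have ha0 : 0 ≤ a := Finset.prod_nonneg fun j _ => by positivity
  calc Real.exp (N ((1 / 2 : ℝ) • absVec x))
      ≤ Real.exp (∑ j, |x j| * Real.exp (u j) / 2) * Real.exp (1 - conjR N ξ) := by
        rw [← Real.exp_add]; exact Real.exp_le_exp.2 (by linarith)
    _ ≤ 3 ^ n * (a * Real.exp (conjR (psiR M) (natVec β) + (conjR N ξ + B)))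
          * Real.exp (1 - conjR N ξ) := by gcongr; exact h1.trans (by gcongr)
    _ = 3 ^ n * Real.exp (1 + B) * (a * Real.exp (conjR (psiR M) (natVec β))) := by
        have : Real.exp (conjR (psiR M) (natVec β) + (conjR N ξ + B)) * Real.exp (1 - conjR N ξ)
            = Real.exp (1 + B) * Real.exp (conjR (psiR M) (natVec β)) := by
          rw [← Real.exp_add, ← Real.exp_add]; congr 1; ring
        linear_combination 3 ^ n * a * this

theorem gsSpace_contLE_gSpace {M : Rn n → ℝ} (hM : Superlin M) (he : ∀ x, M x = M (absVec x)) :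
    ContLE (gsSpace M) (gSpace (conjR (psiR M))) (weightedTopology (gsWeight M))
      (weightedTopology (gWeight (conjR (psiR M)))) :=
  contLE_of_weight_le zero_le_one fun β x => ⟨(), by
    rw [abs_gsWeight, one_mul]; exact abs_gWeight_le hM he β x⟩

theorem gsSpace_contLE_gsSpace {M N : Rn n → ℝ} (A : ℝ) (h : ∀ x, N x ≤ M x + A) :
    ContLE (gsSpace M) (gsSpace N) (weightedTopology (gsWeight M))
      (weightedTopology (gsWeight N)) :=
  contLE_of_weight_le (Real.exp_pos A).le fun _ x => ⟨(), by
    rw [abs_gsWeight, abs_gsWeight, ← Real.exp_add]; exact Real.exp_le_exp.2 (by linarith [h x])⟩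

/-- Two steps of the index are spent: one doubling inequality inside the lower estimate, and one to
pass from `M_{ν+1}(|x|/2)` to `M_{ν+2}(x)`. -/
theorem IsGSFamily.gSpace_contLE_gsSpace {M : ℕ → Rn n → ℝ} (hM : IsGSFamily M) (ν : ℕ) :
    ContLE (gSpace (conjR (psiR (M ν)))) (gsSpace (M (ν + 2)))
      (weightedTopology (gWeight (conjR (psiR (M ν))))) (weightedTopology (gsWeight (M (ν + 2)))) := by
  obtain ⟨A, -, hA⟩ := hM.doubling ν
  obtain ⟨A', -, hA'⟩ := hM.doubling (ν + 1)
  obtain ⟨C, hC0, hC⟩ := exists_exp_le_abs_gWeight (hM.superlin ν) (hM.superlin (ν + 1))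
    (hM.even (ν + 1)) (hM.convex (ν + 1)) hA
  refine contLE_of_weight_le (C := Real.exp A' * C) (by positivity) fun _ x => ?_
  obtain ⟨β, hβ⟩ := hC x
  refine ⟨β, ?_⟩
  have h1 : M (ν + 2) x ≤ A' + M (ν + 1) ((1 / 2 : ℝ) • absVec x) := by
    have := hA' ((1 / 2 : ℝ) • absVec x)
    rw [smul_smul, mul_one_div_cancel two_ne_zero, one_smul, ← hM.even] at this
    linarith
  rw [abs_gsWeight, mul_assoc]
  refine (Real.exp_le_exp.2 h1).trans ?_
  rw [Real.exp_add]
  exact mul_le_mul_of_nonneg_left hβ (Real.exp_pos _).le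

theorem IsGSFamily.eqTop {M : ℕ → Rn n → ℝ} (hM : IsGSFamily M) :
    EqTop (GS M hM) (G (fun ν => conjR (psiR (M ν))) hM.isHFamily) (gsTopology M hM)
      (gTopology (fun ν => conjR (psiR (M ν))) hM.isHFamily) :=
  eqTop_indLimTopology (fun ν => ⟨ν, gsSpace_contLE_gSpace (hM.superlin ν) (hM.even ν)⟩)
    fun ν => ⟨ν + 2, hM.gSpace_contLE_gsSpace ν⟩

end Weights

/-! ### The space `W_M` -/

namespace IsWDensity

variable {n : ℕ} {μ : Fin n → ℝ → ℝ}

theorem intervalIntegrable (hμ : IsWDensity μ) (j : Fin n) {a b : ℝ} (ha : 0 ≤ a) (hb : 0 ≤ b) :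
    IntervalIntegrable (μ j) MeasureTheory.volume a b :=
  ((hμ.continuousOn j).mono fun _ ht => (le_min ha hb).trans ht.1).intervalIntegrable

/-- The primitive of `μ_j` lies above its tangents. -/
theorem tangent_le (hμ : IsWDensity μ) (j : Fin n) {s t : ℝ} (hs : 0 ≤ s) (ht : 0 ≤ t) :
    (∫ r in (0 : ℝ)..s, μ j r) + μ j s * (t - s) ≤ ∫ r in (0 : ℝ)..t, μ j r := by
  have h := intervalIntegral.integral_interval_sub_left (hμ.intervalIntegrable j le_rfl ht)
    (hμ.intervalIntegrable j le_rfl hs)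
  rcases le_total s t with hst | hts
  · have h1 : ∫ _r in s..t, μ j s ≤ ∫ r in s..t, μ j r :=
      intervalIntegral.integral_mono_on hst intervalIntegrable_const
        (hμ.intervalIntegrable j hs ht) fun r hr =>
          hμ.monotoneOn j hs (hs.trans hr.1) hr.1
    rw [intervalIntegral.integral_const, smul_eq_mul] at h1
    linarith
  · have h1 : ∫ r in t..s, μ j r ≤ ∫ _r in t..s, μ j s :=
      intervalIntegral.integral_mono_on hts (hμ.intervalIntegrable j ht hs)
        intervalIntegrable_const fun r hr => hμ.monotoneOn j (ht.trans hr.1) hs hr.2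
    rw [intervalIntegral.integral_const, smul_eq_mul] at h1
    rw [intervalIntegral.integral_symm t s] at h
    linarith

theorem nonneg (hμ : IsWDensity μ) (j : Fin n) {s : ℝ} (hs : 0 ≤ s) : 0 ≤ μ j s := by
  rw [← hμ.zero j]
  exact hμ.monotoneOn j (Set.mem_Ici.2 le_rfl) hs hs

theorem integral_mono (hμ : IsWDensity μ) (j : Fin n) {s t : ℝ} (hs : 0 ≤ s) (hst : s ≤ t) :
    ∫ r in (0 : ℝ)..s, μ j r ≤ ∫ r in (0 : ℝ)..t, μ j r := by
  have h1 := hμ.tangent_le j hs (hs.trans hst)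
  have h2 := mul_nonneg (hμ.nonneg j hs) (sub_nonneg.2 hst)
  linarith

theorem integral_nonneg (hμ : IsWDensity μ) (j : Fin n) {s : ℝ} (hs : 0 ≤ s) :
    0 ≤ ∫ r in (0 : ℝ)..s, μ j r := by
  simpa using hμ.integral_mono j le_rfl hs

theorem wFun_convexOn (hμ : IsWDensity μ) : ConvexOn ℝ Set.univ (wFun μ) := by
  refine ⟨convex_univ, fun x _ y _ a b ha hb hab => ?_⟩
  simp only [wFun, smul_eq_mul]
  rw [Finset.mul_sum, Finset.mul_sum, ← Finset.sum_add_distrib]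
  refine Finset.sum_le_sum fun j _ => ?_
  have hs : 0 ≤ a * |x j| + b * |y j| := by positivity
  have h0 : |(a • x + b • y) j| ≤ a * |x j| + b * |y j| := by
    refine (abs_add_le _ _).trans ?_
    simp [abs_mul, abs_of_nonneg ha, abs_of_nonneg hb]
  refine (hμ.integral_mono j (abs_nonneg _) h0).trans ?_
  -- Both tangent inequalities are taken at the mean `s`, so their slope terms cancel on averaging.
  have h1 := mul_le_mul_of_nonneg_left (hμ.tangent_le j hs (abs_nonneg (x j))) ha
  have h2 := mul_le_mul_of_nonneg_left (hμ.tangent_le j hs (abs_nonneg (y j))) hb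
  set s := a * |x j| + b * |y j| with hsdef
  have h3 : a * (μ j s * (|x j| - s)) + b * (μ j s * (|y j| - s)) = 0 := by
    linear_combination μ j s * (-hsdef) - μ j s * s * hab
  have h4 : ∀ I : ℝ, a * I + b * I = I := fun I => by rw [← add_mul, hab, one_mul]
  linarith [h4 (∫ r in (0 : ℝ)..s, μ j r)]

theorem wFun_superlin (hμ : IsWDensity μ) : Superlin (wFun μ) := by
  intro K
  have h : ∀ j, ∃ C : ℝ, ∀ s, 0 ≤ s → K * s - C ≤ ∫ r in (0 : ℝ)..s, μ j r := fun j => by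
    obtain ⟨T, hT, hT0⟩ := ((hμ.tendsto j).eventually_ge_atTop K |>.and
      (eventually_ge_atTop 0)).exists
    -- The tangent at `T`, where `μ_j` has reached `K`, already has slope at least `K`.
    refine ⟨μ j T * T, fun s hs => ?_⟩
    have h1 := hμ.tangent_le j hT0 hs
    have h2 := hμ.integral_nonneg j hT0
    have h3 := mul_le_mul_of_nonneg_right hT hs
    linarith
  choose C hC using h
  refine ⟨∑ j, C j, fun y => ?_⟩
  rw [Finset.mul_sum, ← Finset.sum_sub_distrib]
  exact Finset.sum_le_sum fun j _ => hC j _ (abs_nonneg _)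

theorem wFun_smul_superlin (hμ : IsWDensity μ) {c : ℝ} (hc : 0 < c) :
    Superlin fun x => wFun μ (c • x) := by
  intro K
  obtain ⟨C, hC⟩ := hμ.wFun_superlin (K / c)
  refine ⟨C, fun y => ?_⟩
  have h : ∑ j, |(c • y) j| = c * ∑ j, |y j| := by
    simp [Finset.mul_sum, abs_mul, abs_of_pos hc]
  have := hC (c • y)
  rwa [h, ← mul_assoc, div_mul_cancel₀ _ hc.ne'] at this

theorem wFun_smul_convexOn (hμ : IsWDensity μ) (c : ℝ) :
    ConvexOn ℝ Set.univ fun x => wFun μ (c • x) := by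
  refine ⟨convex_univ, fun x _ y _ a b ha hb hab => ?_⟩
  have h := hμ.wFun_convexOn.2 (Set.mem_univ (c • x)) (Set.mem_univ (c • y)) ha hb hab
  rwa [smul_comm a c x, smul_comm b c y, ← smul_add] at h

theorem isGSFamily (hμ : IsWDensity μ) :
    IsGSFamily fun ν x => wFun μ ((1 / 2 : ℝ) ^ ν • x) where
  convex ν := hμ.wFun_smul_convexOn _
  even ν x := by simp [wFun, absVec, abs_mul]
  mono ν x y hx hy h := Finset.sum_le_sum fun j _ => hμ.integral_mono j (abs_nonneg _) (by
    simp only [PiLp.smul_apply, smul_eq_mul, abs_mul, abs_of_nonneg (hx j), abs_of_nonneg (hy j)]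
    exact mul_le_mul_of_nonneg_left (h j) (abs_nonneg _))
  superlinear ν := (hμ.wFun_smul_superlin (by positivity)).tendsto
  -- Here `M_{ν+1}(2x) = M_ν(x)` exactly; the constant 1 serves only to be positive.
  doubling ν := ⟨1, one_pos, fun x => by
    rw [smul_smul, pow_succ, mul_assoc, one_div_mul_cancel two_ne_zero, mul_one]
    exact le_add_of_nonneg_right zero_le_one⟩

/-- Every `a > 0` exceeds some `2^{-ν}`, and the target of the inclusion of `G(h_ν)` is the step of
`W_M` with `a = 2^{-(ν+2)}`, so `W_M` and `G(𝓗)` are compared directly. -/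
theorem eqTop (hμ : IsWDensity μ) :
    EqTop (W μ hμ)
      (G (fun ν => conjR (psiR fun x => wFun μ ((1 / 2 : ℝ) ^ ν • x))) hμ.isGSFamily.isHFamily)
      (wTopology μ hμ)
      (gTopology (fun ν => conjR (psiR fun x => wFun μ ((1 / 2 : ℝ) ^ ν • x)))
        hμ.isGSFamily.isHFamily) := by
  refine eqTop_indLimTopology (fun a => ?_) fun ν => ?_
  · obtain ⟨ν, hν⟩ := exists_pow_lt_of_lt_one a.2 (by norm_num : (1 / 2 : ℝ) < 1)
    exact ⟨ν, (gsSpace_contLE_gsSpace 0 fun x => by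
      rw [add_zero]; exact hμ.wFun_le (by positivity) hν.le x).trans
        (gsSpace_contLE_gSpace (hμ.isGSFamily.superlin ν) (hμ.isGSFamily.even ν))⟩
  · exact ⟨⟨(1 / 2 : ℝ) ^ (ν + 2), by positivity⟩, hμ.isGSFamily.gSpace_contLE_gsSpace ν⟩

end IsWDensity

end GelfandShilov

end

open GelfandShilov
theorem mainTheorem7 (n : ℕ) :
    (∀ (M : ℕ → Rn n → ℝ) (hM : IsGSFamily M),
      ∃ h : ℕ → Rn n → ℝ, (∀ ν, IsConjWeight (M ν) (h ν)) ∧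
        ∃ hh : IsHFamily h, EqTop (GS M hM) (G h hh) (gsTopology M hM) (gTopology h hh)) ∧
    (∀ (μ : Fin n → ℝ → ℝ) (hμ : IsWDensity μ),
      IsGSFamily (fun ν x => wFun μ ((1 / 2 : ℝ) ^ ν • x)) ∧
      ∃ h : ℕ → Rn n → ℝ,
        (∀ ν, IsConjWeight (fun x => wFun μ ((1 / 2 : ℝ) ^ ν • x)) (h ν)) ∧
        ∃ hh : IsHFamily h, EqTop (W μ hμ) (G h hh) (wTopology μ hμ) (gTopology h hh)) :=
  ⟨fun _ hM => ⟨_, fun ν => isConjWeight_conjR (hM.superlin ν), hM.isHFamily, hM.eqTop⟩,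
    fun _ hμ => ⟨hμ.isGSFamily, _, fun ν => isConjWeight_conjR (hμ.isGSFamily.superlin ν),
      hμ.isGSFamily.isHFamily, hμ.eqTop⟩⟩
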